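/- Throughout, $\overline{\mathbb Q}$ denotes the field of algebraic numbers in $\mathbb C$, and for a discrete group $G$ a matrix $A\in M(d\times d,\mathbb C G)$ acts as a bounded operator on the Hilbert space $l^2(G)^d$ by left convolution, $(Af)_i=\sum_j a_{ij}*f_j$. A group $G$ has the \emph{algebraic eigenvalue property} if for every $d$ and every $A\in M(d\times d,\overline{\mathbb Q}G)$ all eigenvalues of $A$ acting on $l^2(G)^d$ are algebraic numbers. It has the \emph{algebraic eigenvalue property for rational matrices} if the same holds for every $d$ and every $A\in M(d\times d,\mathbb Q G)$. Let $G$ be a group with a finite symmetric generating set $S$, and let $H$ be an arbitrary group. $G$ is a \emph{generalized amenable extension} of $H$ if there are a nonempty set $X$ with a free left $G$-action and a commuting free right $H$-action, and $H$-invariant subsets $X_1\subset X_2\subset\cdots\subset X$ with $\bigcup_k X_k=X$ and $|X_k/H|<\infty$ for all $k$, such that $$\frac{|(S\cdot X_k\setminus X_k)/H|}{|X_k/H|}\longrightarrow 0\qquad (k\to\infty).$$ \textbf{Theorem.} Let $G$ be a generalized amenable extension of $H$. If $H$ has the algebraic eigenvalue property, then so does $G$. If $H$ has the algebraic eigenvalue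 property for rational matrices, then so does $G$. -/

import Mathlib

open scoped Pointwise ENNReal

universe w u v

namespace L2Group

noncomputable section

/-- The Hilbert space `l²(G)` of square summable functions `G → ℂ`. -/
abbrev EllTwo (G : Type*) : Type _ := lp (fun _ : G => ℂ) 2

/-- The Hilbert space `l²(G)^d`. -/
abbrev EllTwoPow (G : Type*) (d : ℕ) : Type _ := PiLp 2 (fun _ : Fin d => EllTwo G)

section Operators

variable {G : Type*} [Group G]

/-- Translating a square summable function keeps it square summable. -/
theorem memlp_translate (g : G) (f : EllTwo G) :
    Memℓp (fun x : G => f (g⁻¹ * x)) 2 := by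
  have h := (memℓp_gen_iff (p := 2) (by norm_num)).1 (lp.memℓp f)
  exact (memℓp_gen_iff (p := 2) (by norm_num)).2
    ((Equiv.mulLeft g⁻¹).summable_iff.2 h)

/-- Left translation by `g`, `(g f)(x) = f (g⁻¹ x)`, as an isometry of `l²(G)`. -/
def leftTranslation (g : G) : EllTwo G →ₗᵢ[ℂ] EllTwo G where
  toFun f := ⟨fun x => f (g⁻¹ * x), memlp_translate g f⟩
  map_add' _ _ := rfl
  map_smul' _ _ := rfl
  norm_map' f := by
    rw [lp.norm_eq_tsum_rpow (by norm_num), lp.norm_eq_tsum_rpow (by norm_num)]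
    congr 1
    exact (Equiv.mulLeft g⁻¹).tsum_eq (fun x => ‖f x‖ ^ (2 : ℝ≥0∞).toReal)

variable {K : Type*} [Field K] [Algebra K ℂ]

/-- Left convolution by `a = ∑ a_g g ∈ K[G]`: the bounded operator `f ↦ ∑_g a_g (g f)` on `l²(G)`.
-/
def convolution (a : MonoidAlgebra K G) : EllTwo G →L[ℂ] EllTwo G :=
  ∑ g ∈ a.coeff.support,
    algebraMap K ℂ (a.coeff g) • (leftTranslation g).toContinuousLinearMap

/-- The bounded operator on `l²(G)^d` induced by left convolution with a `d × d` matrix over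
`K[G]`: the `i`-th component of the image of `f` is `∑_j A_{ij} * f_j`. -/
def matrixOperator {d : ℕ} (A : Matrix (Fin d) (Fin d) (MonoidAlgebra K G)) :
    EllTwoPow G d →L[ℂ] EllTwoPow G d :=
  (PiLp.continuousLinearEquiv 2 ℂ (fun _ : Fin d => EllTwo G)).symm.toContinuousLinearMap ∘L
    ContinuousLinearMap.pi (fun i => ∑ j, convolution (A i j) ∘L
      PiLp.proj 2 (fun _ : Fin d => EllTwo G) j)

end Operators

/-- All eigenvalues of all square matrices over `K[G]`, acting on `l²(G)^d`, are algebraic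
numbers. -/
def AlgebraicEigenvaluesOver (K : Type*) [Field K] [Algebra K ℂ] (G : Type*) [Group G] : Prop :=
  ∀ (d : ℕ) (A : Matrix (Fin d) (Fin d) (MonoidAlgebra K G)) (z : ℂ),
    Module.End.HasEigenvalue (matrixOperator A : EllTwoPow G d →ₗ[ℂ] EllTwoPow G d) z →
      IsAlgebraic ℚ z

/-- The algebraic eigenvalue property (for algebraic matrices): the coefficient field is the field
of algebraic numbers in `ℂ`. -/
def AlgebraicEigenvalueProperty (G : Type*) [Group G] : Prop :=
  AlgebraicEigenvaluesOver (algebraicClosure ℚ ℂ) G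

/-- The algebraic eigenvalue property for rational matrices. -/
def RationalAlgebraicEigenvalueProperty (G : Type*) [Group G] : Prop :=
  AlgebraicEigenvaluesOver ℚ G

/-- The image `Y/H` of a subset `Y` of `X` in the orbit space of a right action of `H` on `X`
(a right action of `H` is an action of `Hᵐᵒᵖ`). -/
def modRight (H : Type*) [Group H] {X : Type*} [MulAction Hᵐᵒᵖ X] (Y : Set X) :
    Set (MulAction.orbitRel.Quotient Hᵐᵒᵖ X) :=
  Quotient.mk (MulAction.orbitRel Hᵐᵒᵖ X) '' Y

/-- An increasing exhaustion `E 0 ⊆ E 1 ⊆ ⋯` of `X` by right `H`-invariant subsets with finitely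
many `H`-orbits such that `|(S · E k \ E k)/H| / |(E k)/H| → 0`. -/
structure IsAmenableExhaustion {G : Type*} [Group G] (H : Type*) [Group H] {X : Type*}
    [MulAction G X] [MulAction Hᵐᵒᵖ X] (S : Set G) (E : ℕ → Set X) : Prop where
  mono : Monotone E
  exhausts : ⋃ k, E k = Set.univ
  invariant : ∀ (k : ℕ) (h : H), ∀ x ∈ E k, MulOpposite.op h • x ∈ E k
  finite_mod : ∀ k, (modRight H (E k)).Finite
  tendsto_ratio : Filter.Tendsto
    (fun k => ((modRight H ((S • E k) \ E k)).ncard : ℝ) / ((modRight H (E k)).ncard : ℝ))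
    Filter.atTop (nhds 0)

/-- `G` is a generalized amenable extension of `H`: `G` has a finite symmetric generating set `S`,
and there is a nonempty set `X` with a free left `G`-action, a commuting free right `H`-action and
an amenable exhaustion with respect to `S`. The set `X` ranges over an arbitrary universe. -/
def IsGeneralizedAmenableExtension (G : Type u) [Group G] (H : Type v) [Group H] :
    Prop :=
  ∃ S : Set G, S.Finite ∧ (∀ s ∈ S, s⁻¹ ∈ S) ∧ Subgroup.closure S = ⊤ ∧
    ∃ (X : Type w) (_ : MulAction G X) (_ : MulAction Hᵐᵒᵖ X),
      Nonempty X ∧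
      (∀ (g : G) (h : H) (x : X),
        g • (MulOpposite.op h • x) = MulOpposite.op h • (g • x)) ∧
      (∀ (g : G) (x : X), g • x = x → g = 1) ∧
      (∀ (h : H) (x : X), MulOpposite.op h • x = x → h = 1) ∧
      ∃ E : ℕ → Set X, IsAmenableExhaustion H S E

end

end L2Group

/-! Suppose `A` over `K[G]` has an eigenvector `f` with transcendental eigenvalue `z`. Restricting
the action of `A` on functions on `X` to `E k` gives a matrix over `K[H]`, of size `d` times the
number `N` of `H`-orbits in `E k`. By the property of `H`, `z` is not an eigenvalue of this
`compression`, so `B = compression - z` is injective.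

Now estimate the von Neumann dimension over `H` of the space `V` of vectors whose image under `B`
lives on the boundary rows `D`. Upper bound: since `B` is injective, `dim V ≤ |D|`
(`RightEquivariant.sum_norm_starProjection_sq_le`), and `|D|` is at most a constant times the number
of boundary orbits (`exists_card_boundaryRows_le`). Lower bound: copies of `f` spread along
`G`-orbits in `X` and cut off to `E k` lie in `V`. Placing one copy over each `H`-orbit gives `dim V
≥ τ N` with `τ > 0` independent of `k` (`exists_le_card_boundaryRows`). Amenability makes the
boundary `o(N)`, a contradiction. Nothing depends on the coefficient field `K`, so both halves of
the theorem follow at once. -/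

open scoped InnerProductSpace InnerProduct

namespace L2Group

/-! ### Regularised inverses of `T T†` on a Hilbert space. -/

section HilbertSpace

variable {E : Type*} [NormedAddCommGroup E] [InnerProductSpace ℂ E] [CompleteSpace E]

/-- For `ε > 0`, the operator `T T† + ε` is invertible. -/
theorem isUnit_mul_adjoint_add_smul (T : E →L[ℂ] E) {ε : ℝ} (hε : 0 < ε) :
    IsUnit (T * T† + (ε : ℂ) • (1 : E →L[ℂ] E)) := by
  refine ContinuousLinearMap.isUnit_of_forall_le_norm_inner_map _ (c := ⟨ε, hε.le⟩) hε fun x => ?_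
  have h : ⟪(T * T† + (ε : ℂ) • (1 : E →L[ℂ] E)) x, x⟫_ℂ =
      ((‖(T†) x‖ ^ 2 + ε * ‖x‖ ^ 2 : ℝ) : ℂ) := by
    simp [← ContinuousLinearMap.adjoint_inner_right T,
      inner_self_eq_norm_sq_to_K]
  rw [h, Complex.norm_real, Real.norm_of_nonneg (by positivity)]
  change ‖x‖ ^ 2 * ε ≤ _
  nlinarith [sq_nonneg ‖(T†) x‖]

theorem re_inner_mul_adjoint_add_smul (T : E →L[ℂ] E) (ε : ℝ) (x : E) :
    (⟪x, (T * T† + (ε : ℂ) • (1 : E →L[ℂ] E)) x⟫_ℂ).re = ‖(T†) x‖ ^ 2 + ε * ‖x‖ ^ 2 := by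
  have h : ⟪x, (T * T† + (ε : ℂ) • (1 : E →L[ℂ] E)) x⟫_ℂ =
      ((‖(T†) x‖ ^ 2 + ε * ‖x‖ ^ 2 : ℝ) : ℂ) := by
    simp [← ContinuousLinearMap.adjoint_inner_left T,
      inner_self_eq_norm_sq_to_K]
  rw [h, Complex.ofReal_re]

/-- A variational lower bound for the quadratic form of `T† (T T† + ε)⁻¹ T`. -/
theorem le_re_inner_adjoint_inverse (T R : E →L[ℂ] E) {ε : ℝ} (hε : 0 < ε)
    (hR : (T * T† + (ε : ℂ) • (1 : E →L[ℂ] E)) * R = 1) (p g : E) :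
    ‖p‖ ^ 2 - ‖p - (T†) g‖ ^ 2 - ε * ‖g‖ ^ 2 ≤ (⟪p, (T† * (R * T)) p⟫_ℂ).re := by
  -- With `N = T T† + ε` one has `N v = T p`, and the quantity to bound is `Re ⟪v, T p⟫`. Expanding
  -- `⟪v - g, N (v - g)⟫ ≥ 0` and completing the square in `p - T† g` gives the claim.
  set v := R (T p) with hv
  have hN : (T * T† + (ε : ℂ) • (1 : E →L[ℂ] E)) v = T p := by
    rw [hv, ← mul_apply_eq_comp, hR, one_apply_eq_self]
  have h1 := re_inner_mul_adjoint_add_smul T ε (v - g)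
  have h2 := re_inner_mul_adjoint_add_smul T ε g
  have h3 : (⟪g, T p⟫_ℂ).re = (⟪(T†) g, p⟫_ℂ).re := by
    rw [ContinuousLinearMap.adjoint_inner_left]
  have h4 : (⟪p, (T† * (R * T)) p⟫_ℂ).re = (⟪v, T p⟫_ℂ).re := by
    simp only [mul_apply_eq_comp, ContinuousLinearMap.adjoint_inner_right, ← hv]
    exact inner_re_symm (𝕜 := ℂ) _ _
  have h5 : (⟪v, (T * T† + (ε : ℂ) • (1 : E →L[ℂ] E)) g⟫_ℂ).re = (⟪g, T p⟫_ℂ).re := by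
    rw [← hN]
    simp only [add_apply, mul_apply_eq_comp, inner_add_right,
      ← ContinuousLinearMap.adjoint_inner_left T, smul_apply,
      one_apply_eq_self, inner_smul_right, Complex.add_re, Complex.re_ofReal_mul]
    congr 1
    · exact inner_re_symm (𝕜 := ℂ) _ _
    · congr 1
      exact inner_re_symm (𝕜 := ℂ) _ _
  rw [map_sub, inner_sub_left, inner_sub_right, inner_sub_right, hN] at h1
  simp only [Complex.sub_re] at h1
  have h6 := norm_sub_sq (𝕜 := ℂ) p ((T†) g)
  have h7 : RCLike.re ⟪p, (T†) g⟫_ℂ = (⟪(T†) g, p⟫_ℂ).re := inner_re_symm (𝕜 := ℂ) _ _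
  have h8 : 0 ≤ ‖(T†) (v - g)‖ ^ 2 + ε * ‖v - g‖ ^ 2 := by positivity
  rw [h4]
  linarith

end HilbertSpace

noncomputable section

/-! ### The von Neumann trace on right equivariant operators of `l²(H)^n`. -/

section Trace

variable {H : Type*} {n : ℕ}

theorem ellTwoPow_ext {f g : EllTwoPow H n} (h : ∀ b x, f b x = g b x) : f = g := by
  apply PiLp.ext
  intro b
  apply lp.ext
  funext x
  exact h b x

theorem inner_ellTwoPow (f g : EllTwoPow H n) :
    ⟪f, g⟫_ℂ = ∑ b, ∑' h, starRingEnd ℂ (f b h) * g b h := by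
  rw [PiLp.inner_apply]
  refine Finset.sum_congr rfl fun b _ => ?_
  rw [lp.inner_eq_tsum]
  simp [mul_comm]

/-- The unit vector of `l²(H)^n` supported at the point `h` of the `a`-th coordinate. -/
def unitVector (a : Fin n) (h : H) : EllTwoPow H n :=
  open Classical in WithLp.toLp 2 (Pi.single a (lp.single 2 h 1))

theorem unitVector_apply [DecidableEq H] (a b : Fin n) (h x : H) :
    unitVector a h b x = if b = a ∧ x = h then 1 else 0 := by
  unfold unitVector
  by_cases hb : b = a
  · subst hb
    by_cases hx : x = h <;> simp [lp.single_apply, hx]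
  · simp [hb]

theorem inner_unitVector_left (a : Fin n) (h : H) (f : EllTwoPow H n) :
    ⟪unitVector a h, f⟫_ℂ = f a h := by
  classical
  rw [inner_ellTwoPow, Finset.sum_eq_single a, tsum_eq_single h]
  · simp [unitVector_apply]
  · intro x hx; simp [unitVector_apply, hx]
  · intro b _ hb; simp [unitVector_apply, hb]
  · simp

theorem inner_unitVector_right (a : Fin n) (h : H) (f : EllTwoPow H n) :
    ⟪f, unitVector a h⟫_ℂ = starRingEnd ℂ (f a h) := by
  rw [← inner_conj_symm, inner_unitVector_left]

theorem norm_unitVector (a : Fin n) (h : H) : ‖unitVector a h‖ = 1 := by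
  classical
  rw [← sq_eq_sq₀ (norm_nonneg _) zero_le_one, ← inner_self_eq_norm_sq (𝕜 := ℂ),
    inner_unitVector_left, unitVector_apply]
  simp

variable [Group H]

/-- Right translation by `k`, `f ↦ f (· k)`, on `l²(H)`. -/
def rightTranslation (k : H) : EllTwo H →ₗ[ℂ] EllTwo H where
  toFun f := ⟨fun x => f (x * k), (memℓp_gen_iff (p := 2) (by norm_num)).2
    ((Equiv.mulRight k).summable_iff.2 ((memℓp_gen_iff (p := 2) (by norm_num)).1 (lp.memℓp f)))⟩
  map_add' _ _ := rfl
  map_smul' _ _ := rfl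

/-- Right translation by `k` on `l²(H)^n`. -/
def rightTranslationPow (n : ℕ) (k : H) : EllTwoPow H n →ₗ[ℂ] EllTwoPow H n where
  toFun f := WithLp.toLp 2 fun b => rightTranslation k (f b)
  map_add' _ _ := rfl
  map_smul' _ _ := rfl

@[simp]
theorem rightTranslationPow_apply (k : H) (f : EllTwoPow H n) (b : Fin n) (x : H) :
    rightTranslationPow n k f b x = f b (x * k) := rfl

theorem inner_rightTranslationPow (k : H) (f g : EllTwoPow H n) :
    ⟪rightTranslationPow n k f, g⟫_ℂ = ⟪f, rightTranslationPow n k⁻¹ g⟫_ℂ := by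
  rw [inner_ellTwoPow, inner_ellTwoPow]
  refine Finset.sum_congr rfl fun b _ => ?_
  rw [← (Equiv.mulRight k).tsum_eq fun h => starRingEnd ℂ (f b h) * rightTranslationPow n k⁻¹ g b h]
  simp

theorem unitVector_eq_rightTranslationPow (b : Fin n) (h : H) :
    unitVector b h = rightTranslationPow n h⁻¹ (unitVector b 1) := by
  classical
  refine ellTwoPow_ext fun c x => ?_
  simp [unitVector_apply, mul_inv_eq_one]

/-- A bounded operator on `l²(H)^n` is right equivariant if it commutes with right translations. -/
def RightEquivariant (T : EllTwoPow H n →L[ℂ] EllTwoPow H n) : Prop :=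
  ∀ k f, T (rightTranslationPow n k f) = rightTranslationPow n k (T f)

namespace RightEquivariant

variable {S T : EllTwoPow H n →L[ℂ] EllTwoPow H n}

theorem one : RightEquivariant (1 : EllTwoPow H n →L[ℂ] EllTwoPow H n) := fun _ _ => rfl

theorem mul (hS : RightEquivariant S) (hT : RightEquivariant T) : RightEquivariant (S * T) :=
  fun k f => by simp only [mul_apply_eq_comp, hT k, hS k]

theorem add (hS : RightEquivariant S) (hT : RightEquivariant T) : RightEquivariant (S + T) :=
  fun k f => by simp only [add_apply, hT k, hS k, map_add]

theorem smul (hS : RightEquivariant S) (c : ℂ) : RightEquivariant (c • S) :=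
  fun k f => by simp only [smul_apply, hS k, map_smul]

theorem adjoint (hT : RightEquivariant T) : RightEquivariant (T†) := fun k f => by
  refine ext_inner_right ℂ fun g => ?_
  rw [ContinuousLinearMap.adjoint_inner_left, inner_rightTranslationPow, inner_rightTranslationPow,
    ContinuousLinearMap.adjoint_inner_left, hT]

theorem of_mul_eq_one (hT : RightEquivariant T) (h : T * S = 1) (h' : S * T = 1) :
    RightEquivariant S := fun k f => by
  have h1 : ∀ x, T (S x) = x := fun x => congrArg (fun Q => Q x) h
  have h2 : ∀ x, S (T x) = x := fun x => congrArg (fun Q => Q x) h'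
  rw [← h2 (rightTranslationPow n k (S f)), hT, h1]

theorem starProjection (V : Submodule ℂ (EllTwoPow H n)) [V.HasOrthogonalProjection]
    (hV : ∀ k, ∀ f ∈ V, rightTranslationPow n k f ∈ V) : RightEquivariant V.starProjection :=
  fun k f => by
  refine Submodule.eq_starProjection_of_mem_of_inner_eq_zero
    (hV k _ (Submodule.starProjection_apply_mem V f)) fun g hg => ?_
  rw [← map_sub, inner_rightTranslationPow]
  exact Submodule.starProjection_inner_eq_zero f _ (hV _ _ hg)

/-- The matrix coefficients of a right equivariant operator are determined by the images of the
unit vectors at `1`. -/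
theorem apply_unitVector (hS : RightEquivariant S) (a b : Fin n) (h : H) :
    S (unitVector b h) a 1 = S (unitVector b 1) a h⁻¹ := by
  rw [unitVector_eq_rightTranslationPow, hS, rightTranslationPow_apply, one_mul]

/-- Expand `⟪S† δ_a, T δ_a⟫` coordinatewise. Equivariance expresses everything through the images of
the `δ_b` at `1`; summed over `a`, the result is symmetric in `S` and `T` up to swapping `a, b` and
`h ↦ h⁻¹`, which is the source of the trace property. -/
theorem mul_apply_unitVector (hS : RightEquivariant S) (a : Fin n) :
    (S * T) (unitVector a 1) a 1 =
      ∑ b, ∑' h, S (unitVector b 1) a h⁻¹ * T (unitVector a 1) b h := by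
  rw [← inner_unitVector_left, mul_apply_eq_comp,
    ← ContinuousLinearMap.adjoint_inner_left, inner_ellTwoPow]
  refine Finset.sum_congr rfl fun b _ => tsum_congr fun h => ?_
  rw [← hS.apply_unitVector, ← inner_unitVector_right, ContinuousLinearMap.adjoint_inner_left,
    inner_unitVector_left]

/-- The von Neumann trace `T ↦ ∑ₐ ⟨δₐ, T δₐ⟩` is tracial on right equivariant operators. -/
theorem sum_mul_comm (hS : RightEquivariant S) (hT : RightEquivariant T) :
    ∑ a, (S * T) (unitVector a 1) a 1 = ∑ a, (T * S) (unitVector a 1) a 1 := by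
  simp_rw [hS.mul_apply_unitVector, hT.mul_apply_unitVector]
  rw [Finset.sum_comm]
  refine Finset.sum_congr rfl fun a _ => Finset.sum_congr rfl fun b _ => ?_
  rw [← (Equiv.inv H).tsum_eq]
  simp [mul_comm]

end RightEquivariant

end Trace

end

noncomputable section

/-! ### Dimension bounds for spaces of vectors with image supported on few coordinates. -/

section Dimension

variable {H : Type*} [Group H] {n : ℕ}

theorem re_inner_inverse_nonneg {E : Type*} [NormedAddCommGroup E] [InnerProductSpace ℂ E]
    [CompleteSpace E] (T R : E →L[ℂ] E) {ε : ℝ} (hε : 0 < ε)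
    (hR : (T * T† + (ε : ℂ) • (1 : E →L[ℂ] E)) * R = 1) (x : E) : 0 ≤ (⟪x, R x⟫_ℂ).re := by
  have h : (T * T† + (ε : ℂ) • (1 : E →L[ℂ] E)) (R x) = x := by
    rw [← mul_apply_eq_comp, hR, one_apply_eq_self]
  have h1 := re_inner_mul_adjoint_add_smul T ε (R x)
  rw [h] at h1
  rw [← inner_conj_symm, Complex.conj_re, h1]
  positivity

/-- The trace of `T† (T T† + ε)⁻¹ T` is at most the number of coordinates on which the range of
`T` lives. -/
theorem RightEquivariant.sum_adjoint_inverse_le {T R : EllTwoPow H n →L[ℂ] EllTwoPow H n}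
    (hT : RightEquivariant T) {ε : ℝ} (hε : 0 < ε)
    (hR : (T * T† + (ε : ℂ) • (1 : EllTwoPow H n →L[ℂ] EllTwoPow H n)) * R = 1)
    (hR' : R * (T * T† + (ε : ℂ) • (1 : EllTwoPow H n →L[ℂ] EllTwoPow H n)) = 1)
    (D : Finset (Fin n)) (hD : ∀ f, ∀ a ∉ D, T f a = 0) :
    ∑ a, (⟪unitVector a 1, (T† * (R * T)) (unitVector a 1)⟫_ℂ).re ≤ D.card := by
  have hRe : RightEquivariant R :=
    RightEquivariant.of_mul_eq_one ((hT.mul hT.adjoint).add (RightEquivariant.one.smul _)) hR hR'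
  -- Traciality moves `T†` to the right, giving the trace of `R T T† = 1 - ε R`. As `R ≥ 0`, each
  -- diagonal entry is at most `1`; entries outside `D` vanish because `T†` kills those unit
  -- vectors.
  have h := congrArg Complex.re (hT.adjoint.sum_mul_comm (hRe.mul hT))
  simp only [Complex.re_sum] at h
  simp only [inner_unitVector_left]
  rw [h, ← nsmul_one, ← Finset.sum_const, ← Finset.sum_subset (Finset.subset_univ D)]
  · refine Finset.sum_le_sum fun a _ => ?_
    have h1 : R * T * T† = 1 - (ε : ℂ) • R := by
      rw [← hR', mul_add, mul_smul_comm, mul_one, mul_assoc, add_sub_cancel_right]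
    have h2 := re_inner_inverse_nonneg T R hε hR (unitVector a 1)
    rw [← inner_unitVector_left, h1, sub_apply, inner_sub_right, smul_apply, inner_smul_right,
      one_apply_eq_self, inner_self_eq_norm_sq_to_K, norm_unitVector, Complex.sub_re,
      Complex.re_ofReal_mul]
    have := mul_nonneg hε.le h2
    simpa using this
  · intro a _ ha
    have h1 : (T†) (unitVector a 1) = 0 := by
      refine ext_inner_right ℂ fun f => ?_
      rw [ContinuousLinearMap.adjoint_inner_left, inner_unitVector_left, hD f a ha,
        inner_zero_left]
      rfl
    rw [mul_apply_eq_comp, h1, map_zero]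
    rfl

/-- The vectors whose image under `B` vanishes outside the coordinates in `D`. -/
def preimageSupported (B : EllTwoPow H n →L[ℂ] EllTwoPow H n) (D : Finset (Fin n)) :
    Submodule ℂ (EllTwoPow H n) :=
  ⨅ a : {a : Fin n // a ∉ D}, (PiLp.proj 2 (fun _ : Fin n => EllTwo H) (a : Fin n) ∘L B).ker

omit [Group H] in
theorem mem_preimageSupported {B : EllTwoPow H n →L[ℂ] EllTwoPow H n} {D : Finset (Fin n)}
    {f : EllTwoPow H n} : f ∈ preimageSupported B D ↔ ∀ a ∉ D, B f a = 0 := by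
  simp [preimageSupported]

omit [Group H] in
theorem isClosed_preimageSupported (B : EllTwoPow H n →L[ℂ] EllTwoPow H n) (D : Finset (Fin n)) :
    IsClosed (preimageSupported B D : Set (EllTwoPow H n)) := by
  rw [preimageSupported, Submodule.coe_iInf]
  exact isClosed_iInter fun a => ContinuousLinearMap.isClosed_ker _

instance (B : EllTwoPow H n →L[ℂ] EllTwoPow H n) (D : Finset (Fin n)) :
    (preimageSupported B D).HasOrthogonalProjection :=
  haveI := (isClosed_preimageSupported B D).completeSpace_coe
  inferInstance

/-- If `B` is injective and right equivariant, the von Neumann dimension of the space of vectors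
whose image under `B` is supported on the coordinates in `D` is at most `|D|`. -/
theorem RightEquivariant.sum_norm_starProjection_sq_le {B : EllTwoPow H n →L[ℂ] EllTwoPow H n}
    (hB : RightEquivariant B) (hinj : Function.Injective B) (D : Finset (Fin n)) :
    ∑ a, ‖(preimageSupported B D).starProjection (unitVector a 1)‖ ^ 2 ≤ D.card := by
  set V := preimageSupported B D with hV
  set P := V.starProjection with hP
  have hPe : RightEquivariant P := by
    refine RightEquivariant.starProjection V fun k f hf => ?_
    rw [hV, mem_preimageSupported] at hf ⊢
    intro a ha
    rw [hB]
    ext x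
    rw [rightTranslationPow_apply, hf a ha]
    rfl
  set T := B * P with hT
  have hTe : RightEquivariant T := hB.mul hPe
  have hTD : ∀ f, ∀ a ∉ D, T f a = 0 := fun f a ha =>
    mem_preimageSupported.1 (Submodule.starProjection_apply_mem V f) a ha
  have hPP : ∀ f, P (P f) = P f := fun f =>
    Submodule.starProjection_eq_self_iff.2 (Submodule.starProjection_apply_mem V f)
  -- This is where injectivity of `B` enters: `T z = 0` forces `P z = 0`, so the range of `P` is
  -- orthogonal to `ker T`, hence lies in the closure of the range of `T†`.
  have hclos : ∀ f, P f ∈ closure (Set.range (T†)) := fun f => by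
    have h1 : P f ∈ T.kerᗮ := by
      intro z hz
      have hz' : P z = 0 := hinj (by simpa [hT] using hz)
      rw [← Submodule.inner_starProjection_left_eq_right, ← hP, hz', inner_zero_left]
    rw [ContinuousLinearMap.orthogonal_ker, ← SetLike.mem_coe,
      Submodule.topologicalClosure_coe] at h1
    exact h1
  -- The sum is the trace of `P`, which `T† (T T† + ε)⁻¹ T` approximates from below as `ε → 0`. Per
  -- coordinate, `η ^ 2` is the error of approximating `P δ_a` by `T† g_a`, and `η` pays for `ε
  -- ‖g_a‖ ^ 2`.
  have key : ∀ η : ℝ, 0 < η → ∑ a, ‖P (unitVector a 1)‖ ^ 2 ≤ D.card + n * (η ^ 2 + η) := by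
    intro η hη
    have hex : ∀ a : Fin n, ∃ g, ‖P (unitVector a 1) - (T†) g‖ < η := fun a => by
      obtain ⟨_, ⟨g, rfl⟩, hg⟩ := Metric.mem_closure_iff.1 (hclos (unitVector a 1)) η hη
      exact ⟨g, by rwa [← dist_eq_norm]⟩
    choose g hg using hex
    set M := ∑ a, ‖g a‖ ^ 2 with hM
    have hM0 : 0 ≤ M := Finset.sum_nonneg fun a _ => by positivity
    -- A single `ε` serves all coordinates; the `+ 1` covers `M = 0`.
    set ε := η / (M + 1) with hε'
    have hε : 0 < ε := by positivity
    have hεM : ∀ a, ε * ‖g a‖ ^ 2 ≤ η := fun a => by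
      have : ‖g a‖ ^ 2 ≤ M :=
        Finset.single_le_sum (f := fun a => ‖g a‖ ^ 2) (fun a _ => by positivity)
          (Finset.mem_univ a)
      calc ε * ‖g a‖ ^ 2 ≤ ε * (M + 1) := by gcongr; linarith
        _ = η := div_mul_cancel₀ _ (by positivity)
    obtain ⟨⟨N, R, hNR, hRN⟩, hN⟩ := isUnit_mul_adjoint_add_smul T hε
    simp only at hN
    subst hN
    have htr := hTe.sum_adjoint_inverse_le hε hNR hRN D hTD
    have hle : ∀ a, ‖P (unitVector a 1)‖ ^ 2 ≤
        (⟪unitVector a 1, (T† * (R * T)) (unitVector a 1)⟫_ℂ).re + (η ^ 2 + η) := fun a => by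
      have h1 := le_re_inner_adjoint_inverse T R hε hNR (P (unitVector a 1)) (g a)
      have h2 : T (P (unitVector a 1)) = T (unitVector a 1) := congrArg B (hPP _)
      simp only [mul_apply_eq_comp, ContinuousLinearMap.adjoint_inner_right, h2] at h1 ⊢
      have h3 : ‖P (unitVector a 1) - (T†) (g a)‖ ^ 2 ≤ η ^ 2 := by
        gcongr
        exact (hg a).le
      linarith [hεM a]
    calc _ ≤ ∑ a, ((⟪unitVector a 1, (T† * (R * T)) (unitVector a 1)⟫_ℂ).re + (η ^ 2 + η)) :=
          Finset.sum_le_sum fun a _ => hle a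
      _ ≤ _ := by
        rw [Finset.sum_add_distrib, Finset.sum_const, Finset.card_univ, Fintype.card_fin,
          nsmul_eq_mul]
        linarith
  have hlim : Filter.Tendsto (fun η : ℝ => D.card + n * (η ^ 2 + η)) (nhdsWithin 0 (Set.Ioi 0))
      (nhds (D.card + n * ((0 : ℝ) ^ 2 + 0))) :=
    (Continuous.tendsto (by fun_prop) 0).mono_left nhdsWithin_le_nhds
  have := ge_of_tendsto hlim (Filter.eventually_of_mem self_mem_nhdsWithin key)
  simpa using this

omit [Group H] in
/-- Any vector of `V` bounds from below the diagonal coefficient of the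
projection. -/
theorem div_le_norm_starProjection_sq (V : Submodule ℂ (EllTwoPow H n))
    [V.HasOrthogonalProjection] {f : EllTwoPow H n} (hf : f ∈ V) (a : Fin n) (h : H) {r : ℝ}
    (hr : ‖f‖ ≤ r) (hr0 : 0 < r) :
    ‖f a h‖ ^ 2 / r ^ 2 ≤ ‖V.starProjection (unitVector a h)‖ ^ 2 := by
  rw [div_le_iff₀ (by positivity), ← mul_pow]
  gcongr
  -- As `f` is fixed by the self-adjoint projection, its coefficient is the inner product of the
  -- projected unit vector with `f`; Cauchy–Schwarz finishes.
  rw [← inner_unitVector_left, ← Submodule.starProjection_eq_self_iff.2 hf,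
    ← Submodule.inner_starProjection_left_eq_right]
  refine (norm_inner_le_norm _ _).trans ?_
  gcongr

end Dimension

end

/-! ### Boundaries of invariant sets counted in `H`-orbits. -/

section OrbitCounting

variable {G H X : Type*} [Group G] [Group H] [MulAction G X] [MulAction Hᵐᵒᵖ X]

theorem modRight_mono {Y Z : Set X} (h : Y ⊆ Z) : modRight H Y ⊆ modRight H Z :=
  Set.image_mono h

theorem modRight_union (Y Z : Set X) : modRight H (Y ∪ Z) = modRight H Y ∪ modRight H Z :=
  Set.image_union _ _ _

variable [SMulCommClass G Hᵐᵒᵖ X]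

/-- The action of `g` on the set of right `H`-orbits. -/
def smulOrbit (g : G) : MulAction.orbitRel.Quotient Hᵐᵒᵖ X → MulAction.orbitRel.Quotient Hᵐᵒᵖ X :=
  Quotient.map (sa := MulAction.orbitRel Hᵐᵒᵖ X) (sb := MulAction.orbitRel Hᵐᵒᵖ X) (g • ·)
    (by
      rintro _ y ⟨h, rfl⟩
      exact ⟨h, (smul_comm g h y).symm⟩)

theorem smulOrbit_injective (g : G) : Function.Injective (smulOrbit (H := H) (X := X) g) := by
  rintro ⟨x⟩ ⟨y⟩ hxy
  obtain ⟨h, hh⟩ := Quotient.exact hxy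
  refine Quotient.sound ⟨h, ?_⟩
  have : g • h • y = g • x := (smul_comm g h y).trans hh
  exact smul_left_cancel g this

theorem modRight_smul (g : G) (Y : Set X) : modRight H (g • Y) = smulOrbit g '' modRight H Y := by
  simp only [modRight, ← Set.image_smul, Set.image_image]
  rfl

theorem ncard_modRight_smul (g : G) (Y : Set X) :
    (modRight H (g • Y)).ncard = (modRight H Y).ncard := by
  rw [modRight_smul, Set.ncard_image_of_injective _ (smulOrbit_injective g)]

theorem finite_modRight_smul {S : Set G} (hS : S.Finite) {Y : Set X} (hY : (modRight H Y).Finite) :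
    (modRight H (S • Y)).Finite := by
  have : modRight H (S • Y) = ⋃ s ∈ S, modRight H (s • Y) := by
    rw [← Set.iUnion_smul_set, modRight, Set.image_iUnion₂]
    rfl
  rw [this]
  refine hS.biUnion fun s _ => ?_
  rw [modRight_smul]
  exact hY.image _

/-- The number of orbits of `Y` moved out of `Y` by `g` is bounded linearly in the number of orbits
in the boundary of `Y`, uniformly in `Y`. -/
theorem exists_ncard_modRight_le {S : Set G} (hS : S.Finite) (hSinv : ∀ s ∈ S, s⁻¹ ∈ S)
    (hgen : Subgroup.closure S = ⊤) (g : G) :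
    ∃ C : ℕ, ∀ Y : Set X, (modRight H Y).Finite →
      (modRight H {x ∈ Y | g • x ∉ Y}).ncard ≤ C * (modRight H ((S • Y) \ Y)).ncard := by
  have step : ∀ s ∈ S, ∀ g : G, (∃ C : ℕ, ∀ Y : Set X, (modRight H Y).Finite →
      (modRight H {x ∈ Y | g • x ∉ Y}).ncard ≤ C * (modRight H ((S • Y) \ Y)).ncard) →
      ∃ C : ℕ, ∀ Y : Set X, (modRight H Y).Finite →
      (modRight H {x ∈ Y | (s * g) • x ∉ Y}).ncard ≤
        C * (modRight H ((S • Y) \ Y)).ncard := by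
    rintro s hs g ⟨C, hC⟩
    refine ⟨C + 1, fun Y hY => ?_⟩
    -- The points that leave `Y` only with the last letter `s`. Translation by `s * g` carries them
    -- into the outer boundary and is injective on orbits, so each letter costs one further
    -- boundary.
    set Z := {x ∈ Y | g • x ∈ Y ∧ (s * g) • x ∉ Y} with hZ
    have h1 : {x ∈ Y | (s * g) • x ∉ Y} ⊆ {x ∈ Y | g • x ∉ Y} ∪ Z := by
      rintro x ⟨hx, hx'⟩
      by_cases hg : g • x ∈ Y
      · exact Or.inr ⟨hx, hg, hx'⟩
      · exact Or.inl ⟨hx, hg⟩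
    have h2 : (s * g) • Z ⊆ (S • Y) \ Y := by
      rintro _ ⟨x, ⟨_, hg, hx'⟩, rfl⟩
      exact ⟨⟨s, hs, g • x, hg, (mul_smul s g x).symm⟩, hx'⟩
    have h3 : (modRight H Z).ncard ≤ (modRight H ((S • Y) \ Y)).ncard := by
      rw [← ncard_modRight_smul (s * g) Z]
      exact Set.ncard_le_ncard (modRight_mono h2)
        ((finite_modRight_smul hS hY).subset (modRight_mono Set.sdiff_subset))
    have h4 : (modRight H {x ∈ Y | g • x ∉ Y} ∪ modRight H Z).Finite :=
      hY.subset (Set.union_subset (modRight_mono fun x hx => hx.1) (modRight_mono fun x hx => hx.1))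
    calc _ ≤ (modRight H {x ∈ Y | g • x ∉ Y} ∪ modRight H Z).ncard :=
          Set.ncard_le_ncard (by rw [← modRight_union]; exact modRight_mono h1) h4
      _ ≤ _ := Set.ncard_union_le _ _
      _ ≤ _ := by rw [add_mul, one_mul]; exact add_le_add (hC Y hY) h3
  have hg : g ∈ Subgroup.closure S := hgen ▸ Subgroup.mem_top g
  induction hg using Subgroup.closure_induction_left with
  | one =>
    refine ⟨0, fun Y _ => ?_⟩
    have : {x ∈ Y | (1 : G) • x ∉ Y} = ∅ := by
      ext x
      simp
    rw [this]
    simp [modRight]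
  | mul_left s hs g _ ih => exact step s hs g ih
  | inv_mul_cancel s hs g _ ih => exact step _ (hSinv s hs) g ih

end OrbitCounting

noncomputable section

/-! ### Coordinate formulas for convolution operators. -/

section Convolution

variable {G K : Type*} [Group G] [Field K] [Algebra K ℂ]

theorem convolution_apply (a : MonoidAlgebra K G) (f : EllTwo G) (x : G) :
    convolution a f x = ∑ g ∈ a.coeff.support, algebraMap K ℂ (a.coeff g) * f (g⁻¹ * x) := by
  simp only [convolution, sum_apply, lp.coeFn_sum, Finset.sum_apply]
  rfl

theorem convolution_zero : convolution (0 : MonoidAlgebra K G) = 0 := by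
  simp [convolution]

theorem convolution_add (a b : MonoidAlgebra K G) :
    convolution (a + b) = convolution a + convolution b := by
  classical
  have h : ∀ a : MonoidAlgebra K G, convolution a = a.coeff.sum fun g c =>
    algebraMap K ℂ c • (leftTranslation g).toContinuousLinearMap := fun a => rfl
  rw [h, h, h, MonoidAlgebra.coeff_add, Finsupp.sum_add_index']
  · simp
  · intro g c c'
    rw [map_add, add_smul]

theorem convolution_single_apply (g : G) (c : K) (f : EllTwo G) (x : G) :
    convolution (MonoidAlgebra.single g c) f x = algebraMap K ℂ c * f (g⁻¹ * x) := by
  rw [convolution_apply]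
  by_cases hc : c = 0
  · simp [hc]
  · simp [MonoidAlgebra.coeff_single, Finsupp.support_single, hc]

theorem convolution_sum {ι : Type*} (s : Finset ι) (a : ι → MonoidAlgebra K G) :
    convolution (∑ i ∈ s, a i) = ∑ i ∈ s, convolution (a i) := by
  classical
  induction s using Finset.induction_on with
  | empty => simp [convolution_zero]
  | insert i s hi ih => rw [Finset.sum_insert hi, Finset.sum_insert hi, convolution_add, ih]

theorem matrixOperator_apply {d : ℕ} (A : Matrix (Fin d) (Fin d) (MonoidAlgebra K G))
    (f : EllTwoPow G d) (i : Fin d) (x : G) :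
    matrixOperator A f i x = ∑ j, convolution (A i j) (f j) x := by
  have : matrixOperator A f i = ∑ j, convolution (A i j) (f j) := by
    simp [matrixOperator]
  rw [this, lp.coeFn_sum, Finset.sum_apply]

theorem rightEquivariant_matrixOperator {d : ℕ}
    (A : Matrix (Fin d) (Fin d) (MonoidAlgebra K G)) : RightEquivariant (matrixOperator A) :=
  fun k f => by
  refine ellTwoPow_ext fun i x => ?_
  simp only [rightTranslationPow_apply, matrixOperator_apply, convolution_apply, mul_assoc]

end Convolution

/-! ### Compressing a matrix over `K[G]` to finitely many `H`-orbits. -/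

section Compression

variable {G H K X : Type*} [Group G] [Group H] [Field K] [Algebra K ℂ] [MulAction G X]
  [MulAction Hᵐᵒᵖ X] {J : Type*} {d n : ℕ}

/-- The compression of a matrix `A` over `K[G]` to the right `H`-set with orbit representatives
`q j`, as a matrix over `K[H]`. -/
def compression (A : Matrix (Fin d) (Fin d) (MonoidAlgebra K G)) (q : J → X)
    (e : Fin n ≃ J × Fin d) : Matrix (Fin n) (Fin n) (MonoidAlgebra K H) := fun a b =>
  open Classical in
  ∑ g ∈ (A (e a).2 (e b).2).coeff.support,
    if h : ∃ h : H, g • q (e b).1 = MulOpposite.op h • q (e a).1 then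
      MonoidAlgebra.single h.choose ((A (e a).2 (e b).2).coeff g) else 0

/-- The rows of the compression of `A` which lose some entry of `A`. -/
def boundaryRows (H : Type*) [Group H] [MulAction Hᵐᵒᵖ X]
    (A : Matrix (Fin d) (Fin d) (MonoidAlgebra K G)) (q : J → X)
    (e : Fin n ≃ J × Fin d) : Finset (Fin n) :=
  open Classical in
  {a | ∃ c, ∃ g ∈ (A (e a).2 c).coeff.support,
    ∀ j, ¬ ∃ h : H, g • q j = MulOpposite.op h • q (e a).1}

variable [SMulCommClass G Hᵐᵒᵖ X]

/-- Outside of the boundary rows, the compression acts like `A` acts on functions on `X`. -/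
theorem matrixOperator_compression_apply [Fintype J]
    (A : Matrix (Fin d) (Fin d) (MonoidAlgebra K G)) {q : J → X} (e : Fin n ≃ J × Fin d)
    (hq : ∀ i j, ∀ h : H, q i = MulOpposite.op h • q j → i = j)
    (φ : Fin d → X → ℂ) (f : EllTwoPow H n)
    (hf : ∀ b x, f b x = φ (e b).2 (MulOpposite.op x • q (e b).1)) {a : Fin n}
    (ha : a ∉ boundaryRows H A q e) (x : H) :
    matrixOperator (compression (H := H) A q e) f a x =
      ∑ c, ∑ g ∈ (A (e a).2 c).coeff.support, algebraMap K ℂ ((A (e a).2 c).coeff g) *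
        φ c (g⁻¹ • MulOpposite.op x • q (e a).1) := by
  classical
  have h1 : ∀ b, convolution (compression (H := H) A q e a b) (f b) x =
      ∑ g ∈ (A (e a).2 (e b).2).coeff.support,
        if ∃ h : H, g • q (e b).1 = MulOpposite.op h • q (e a).1 then
          algebraMap K ℂ ((A (e a).2 (e b).2).coeff g) *
            φ (e b).2 (g⁻¹ • MulOpposite.op x • q (e a).1) else 0 := by
    intro b
    rw [compression, convolution_sum, sum_apply, lp.coeFn_sum, Finset.sum_apply]
    refine Finset.sum_congr rfl fun g _ => ?_
    split_ifs with h
    · rw [convolution_single_apply, hf]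
      congr 2
      -- Whichever `h` was chosen, `g q_b = q_a h` gives `q_b h⁻¹ x = g⁻¹ q_a x`, so no freeness is
      -- needed here.
      have h2 := h.choose_spec
      rw [MulOpposite.op_mul, mul_smul, MulOpposite.op_inv, smul_comm g⁻¹]
      congr 1
      rw [inv_smul_eq_iff, ← smul_comm g⁻¹, ← h2, inv_smul_smul]
    · rw [convolution_zero]
      rfl
  rw [matrixOperator_apply, Finset.sum_congr rfl fun b _ => h1 b,
    e.sum_comp fun b : J × Fin d => ∑ g ∈ (A (e a).2 b.2).coeff.support,
        if ∃ h : H, g • q b.1 = MulOpposite.op h • q (e a).1 then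
          algebraMap K ℂ ((A (e a).2 b.2).coeff g) *
            φ b.2 (g⁻¹ • MulOpposite.op x • q (e a).1) else 0,
    Fintype.sum_prod_type_right]
  refine Finset.sum_congr rfl fun c _ => ?_
  dsimp only
  rw [Finset.sum_comm]
  refine Finset.sum_congr rfl fun g hg => ?_
  -- Off the boundary rows some representative `q j` satisfies `g q_j ∈ q_a H`; it is unique since
  -- distinct representatives lie in distinct orbits, so the sum over representatives collapses to
  -- the full term of `A`.
  have hex : ∃ j, ∃ h : H, g • q j = MulOpposite.op h • q (e a).1 := by
    by_contra! hcon
    refine ha ?_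
    simp only [boundaryRows, Finset.mem_filter, Finset.mem_univ, true_and]
    exact ⟨c, g, hg, fun j ⟨h, hh⟩ => hcon j h hh⟩
  obtain ⟨j, h, hj⟩ := hex
  rw [Finset.sum_eq_single j, if_pos ⟨h, hj⟩]
  · intro i _ hij
    refine if_neg ?_
    rintro ⟨h', hi⟩
    refine hij (hq i j (h⁻¹ * h') ?_)
    rw [MulOpposite.op_mul, mul_smul]
    apply smul_left_cancel g
    rw [smul_comm g, smul_comm g, hj, hi, MulOpposite.op_inv, inv_smul_smul]
  · simp

end Compression

end

noncomputable section

/-! ### Moving an eigenvector from `G` to `X` and restricting it to `H`-orbits. -/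

section Transport

theorem hasSum_norm_sq {G : Type*} (f : EllTwo G) : HasSum (fun x => ‖f x‖ ^ 2) (‖f‖ ^ 2) := by
  simpa using lp.hasSum_norm (p := 2) (by norm_num) f

variable {G H K X : Type*} [Group G] [Group H] [Field K] [Algebra K ℂ] [MulAction G X]
  [MulAction Hᵐᵒᵖ X] {J : Type*} {d n : ℕ}

/-- The function on `X` that is `f` on the orbit of `y` and zero elsewhere. -/
def transport (f : EllTwoPow G d) (y : X) (c : Fin d) : X → ℂ :=
  Function.extend (fun g : G => g • y) (f c) 0

theorem injective_smul_of_free (hG : ∀ (g : G) (x : X), g • x = x → g = 1) (y : X) :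
    Function.Injective fun g : G => g • y := fun g g' h => by
  have : (g'⁻¹ * g) • y = y := by
    rw [mul_smul, inv_smul_eq_iff]
    exact h
  exact (inv_mul_eq_one.1 (hG _ _ this)).symm

theorem transport_smul (hG : ∀ (g : G) (x : X), g • x = x → g = 1) (f : EllTwoPow G d) (y : X)
    (c : Fin d) (g : G) : transport f y c (g • y) = f c g :=
  (injective_smul_of_free hG y).extend_apply _ _ g

/-- On the orbit of `y`, which freeness identifies with `G`, this is the eigenvalue equation for
`f`. The complement of the orbit is `G`-invariant, so both sides vanish there. -/
theorem transport_eigenvector (hG : ∀ (g : G) (x : X), g • x = x → g = 1)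
    (A : Matrix (Fin d) (Fin d) (MonoidAlgebra K G)) {f : EllTwoPow G d} {z : ℂ}
    (hf : matrixOperator A f = z • f) (y : X) (c : Fin d) (x : X) :
    ∑ c', ∑ g ∈ (A c c').coeff.support, algebraMap K ℂ ((A c c').coeff g) *
        transport f y c' (g⁻¹ • x) = z * transport f y c x := by
  by_cases hx : ∃ g : G, g • y = x
  · obtain ⟨k, rfl⟩ := hx
    have h : matrixOperator A f c k = z * f c k := by rw [hf]; rfl
    simp only [matrixOperator_apply, convolution_apply] at h
    simp only [← mul_smul, transport_smul hG]
    exact h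
  · have h0 : ∀ c, ∀ g : G, transport f y c (g • x) = 0 := fun c g =>
      Function.extend_apply' _ _ _ (by
        rintro ⟨k, hk⟩
        exact hx ⟨g⁻¹ * k, by rw [mul_smul, inv_smul_eq_iff]; exact hk⟩)
    have h1 := h0 c 1
    rw [one_smul] at h1
    rw [h1, mul_zero]
    simp [h0]

theorem hasSum_norm_transport_sq (hG : ∀ (g : G) (x : X), g • x = x → g = 1) (f : EllTwoPow G d)
    (y : X) (c : Fin d) : HasSum (fun x => ‖transport f y c x‖ ^ 2) (‖f c‖ ^ 2) := by
  have h : (fun x => ‖transport f y c x‖ ^ 2) =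
      Function.extend (fun g : G => g • y) (fun g => ‖f c g‖ ^ 2) 0 := by
    funext x
    by_cases hx : ∃ g : G, g • y = x
    · obtain ⟨k, rfl⟩ := hx
      rw [transport_smul hG, (injective_smul_of_free hG y).extend_apply]
    · rw [transport, Function.extend_apply' _ _ _ hx, Function.extend_apply' _ _ _ hx]
      simp
  rw [h, hasSum_extend_zero (injective_smul_of_free hG y)]
  exact hasSum_norm_sq (f c)

theorem injective_op_smul (hH : ∀ (h : H) (x : X), MulOpposite.op h • x = x → h = 1) {q : J → X}
    (hq : ∀ i j, ∀ h : H, q i = MulOpposite.op h • q j → i = j) :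
    Function.Injective fun p : J × H => MulOpposite.op p.2 • q p.1 := by
  rintro ⟨i, h⟩ ⟨j, k⟩ hjk
  have h1 : q i = MulOpposite.op (k * h⁻¹) • q j := by
    rw [MulOpposite.op_mul, mul_smul, MulOpposite.op_inv, eq_inv_smul_iff]
    exact hjk
  obtain rfl := hq i j _ h1
  have := hH _ _ h1.symm
  rw [mul_inv_eq_one] at this
  rw [this]

/-- The restriction of the transport of `f` to the orbits represented by `q`, as an element of
`l²(H)^n`. -/
theorem exists_restrict_transport [Finite J] (hG : ∀ (g : G) (x : X), g • x = x → g = 1)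
    (hH : ∀ (h : H) (x : X), MulOpposite.op h • x = x → h = 1) {q : J → X}
    (hq : ∀ i j, ∀ h : H, q i = MulOpposite.op h • q j → i = j) (e : Fin n ≃ J × Fin d)
    (f : EllTwoPow G d) (y : X) :
    ∃ w : EllTwoPow H n, ‖w‖ ≤ ‖f‖ ∧
      ∀ b x, w b x = transport f y (e b).2 (MulOpposite.op x • q (e b).1) := by
  have := Fintype.ofFinite J
  have hinj := injective_op_smul hH hq
  have hs : ∀ c, Summable fun p : J × H => ‖transport f y c (MulOpposite.op p.2 • q p.1)‖ ^ 2 :=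
    fun c => (hasSum_norm_transport_sq hG f y c).summable.comp_injective hinj
  have hmem : ∀ b, Memℓp (fun x : H =>
      transport f y (e b).2 (MulOpposite.op x • q (e b).1)) 2 := fun b => by
    refine (memℓp_gen_iff (p := 2) (by norm_num)).2 ?_
    simpa using (hs (e b).2).prod_factor (e b).1
  refine ⟨WithLp.toLp 2 fun b => ⟨_, hmem b⟩, ?_, fun b x => rfl⟩
  rw [← sq_le_sq₀ (norm_nonneg _) (norm_nonneg _), PiLp.norm_sq_eq_of_L2, PiLp.norm_sq_eq_of_L2]
  have h1 : ∀ b, ‖(⟨_, hmem b⟩ : EllTwo H)‖ ^ 2 =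
      ∑' x : H, ‖transport f y (e b).2 (MulOpposite.op x • q (e b).1)‖ ^ 2 := fun b =>
    (hasSum_norm_sq (⟨_, hmem b⟩ : EllTwo H)).tsum_eq.symm
  calc ∑ b, ‖(⟨_, hmem b⟩ : EllTwo H)‖ ^ 2
      = ∑ b, ∑' x : H, ‖transport f y (e b).2 (MulOpposite.op x • q (e b).1)‖ ^ 2 :=
        Finset.sum_congr rfl fun b _ => h1 b
    _ = ∑ c, ∑ j, ∑' x : H, ‖transport f y c (MulOpposite.op x • q j)‖ ^ 2 := by
        rw [e.sum_comp fun b : J × Fin d =>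
          ∑' x : H, ‖transport f y b.2 (MulOpposite.op x • q b.1)‖ ^ 2,
          Fintype.sum_prod_type_right]
    _ ≤ ∑ c, ‖f c‖ ^ 2 := by
        refine Finset.sum_le_sum fun c _ => ?_
        -- The points `q_j x` are pairwise distinct by freeness of `H`, so the restricted sum counts
        -- each value on `X` at most once.
        rw [← tsum_fintype (L := .unconditional _), ← (hs c).tsum_prod, ← (hasSum_norm_transport_sq hG f y c).tsum_eq]
        exact tsum_comp_le_tsum_of_inj (hasSum_norm_transport_sq hG f y c).summable
          (fun _ => by positivity) hinj

end Transport

/-! ### Comparing the two dimension bounds. -/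

section Main

variable {G H K X : Type*} [Group G] [Group H] [Field K] [Algebra K ℂ] [MulAction G X]
  [MulAction Hᵐᵒᵖ X] [SMulCommClass G Hᵐᵒᵖ X] {d : ℕ}

/-- If `z` is an eigenvalue of `A` but not of its compression, then the compression has many
boundary rows. -/
theorem exists_le_card_boundaryRows (hG : ∀ (g : G) (x : X), g • x = x → g = 1)
    (hH : ∀ (h : H) (x : X), MulOpposite.op h • x = x → h = 1)
    (A : Matrix (Fin d) (Fin d) (MonoidAlgebra K G)) {f : EllTwoPow G d} {z : ℂ}
    (hf : matrixOperator A f = z • f) (hf0 : f ≠ 0) :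
    ∃ τ : ℝ, 0 < τ ∧ ∀ (J : Type w) [Fintype J] (n : ℕ) (q : J → X) (e : Fin n ≃ J × Fin d),
      (∀ i j, ∀ h : H, q i = MulOpposite.op h • q j → i = j) →
      ¬ Module.End.HasEigenvalue (matrixOperator (compression (H := H) A q e) :
        EllTwoPow H n →ₗ[ℂ] EllTwoPow H n) z →
      τ * Fintype.card J ≤ (boundaryRows H A q e).card := by
  obtain ⟨i, g₀, hig⟩ : ∃ i g, f i g ≠ 0 := by
    by_contra! h
    exact hf0 (ellTwoPow_ext h)
  have hfn : 0 < ‖f‖ := norm_pos_iff.2 hf0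
  refine ⟨‖f i g₀‖ ^ 2 / ‖f‖ ^ 2, by positivity, fun J _ n q e hq hz => ?_⟩
  set A' := compression (H := H) A q e
  set D := boundaryRows H A q e
  set B : EllTwoPow H n →L[ℂ] EllTwoPow H n := matrixOperator A' + (-z) • 1 with hB
  have hBa : ∀ w, B w = matrixOperator A' w - z • w := fun w => by simp [hB, sub_eq_add_neg]
  have hBe : RightEquivariant B :=
    (rightEquivariant_matrixOperator A').add (RightEquivariant.one.smul _)
  have hinj : Function.Injective B := by
    rw [injective_iff_map_eq_zero]
    intro w hw
    by_contra hw0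
    refine hz (Module.End.hasEigenvalue_of_hasEigenvector
      (Module.End.hasEigenvector_iff.2 ⟨Module.End.mem_eigenspace_iff.2 ?_, hw0⟩))
    rw [hBa, sub_eq_zero] at hw
    exact hw
  have hdim := hBe.sum_norm_starProjection_sq_le hinj D
  have hlow : ∀ j : J, ‖f i g₀‖ ^ 2 / ‖f‖ ^ 2 ≤
      ‖(preimageSupported B D).starProjection (unitVector (e.symm (j, i)) 1)‖ ^ 2 := fun j => by
    -- The base point `g₀⁻¹ q_j` puts the nonzero value `f i g₀` exactly at `q_j`, making the lower
    -- bound the same for every orbit.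
    obtain ⟨w, hwn, hw⟩ := exists_restrict_transport hG hH hq e f (g₀⁻¹ • q j)
    have hwV : w ∈ preimageSupported B D := by
      refine mem_preimageSupported.2 fun a ha => ?_
      ext x
      have h1 := matrixOperator_compression_apply A e hq _ w hw ha x
      rw [transport_eigenvector hG A hf, ← hw] at h1
      rw [hBa]
      exact sub_eq_zero.2 h1
    have hwj : w (e.symm (j, i)) 1 = f i g₀ := by
      rw [hw, Equiv.apply_symm_apply, MulOpposite.op_one, one_smul]
      dsimp only
      have h1 := transport_smul hG f (g₀⁻¹ • q j) i g₀
      rwa [smul_inv_smul] at h1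
    have := div_le_norm_starProjection_sq _ hwV (e.symm (j, i)) 1 hwn hfn
    rwa [hwj] at this
  refine le_trans ?_ hdim
  -- Of the `d` coordinates over each orbit only the `i`-th is kept.
  rw [← e.symm.sum_comp, Fintype.sum_prod_type]
  calc _ = ∑ _j : J, ‖f i g₀‖ ^ 2 / ‖f‖ ^ 2 := by
        rw [Finset.sum_const, Finset.card_univ, nsmul_eq_mul, mul_comm]
    _ ≤ _ := Finset.sum_le_sum fun j _ => (hlow j).trans
        (Finset.single_le_sum (f := fun c => ‖(preimageSupported B D).starProjection
          (unitVector (e.symm (j, c)) 1)‖ ^ 2) (fun c _ => by positivity) (Finset.mem_univ i))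

omit [Algebra K ℂ] in
/-- The number of boundary rows is bounded linearly in the number of boundary orbits. -/
theorem exists_card_boundaryRows_le {S : Set G} (hS : S.Finite) (hSinv : ∀ s ∈ S, s⁻¹ ∈ S)
    (hgen : Subgroup.closure S = ⊤) (A : Matrix (Fin d) (Fin d) (MonoidAlgebra K G)) :
    ∃ C : ℕ, ∀ Y : Set X, (modRight H Y).Finite →
      (∀ (h : H), ∀ x ∈ Y, MulOpposite.op h • x ∈ Y) →
      ∀ (n : ℕ) (e : Fin n ≃ modRight H Y × Fin d),
      (boundaryRows H A (fun j : modRight H Y => Quotient.out j.1) e).card ≤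
        C * (modRight H ((S • Y) \ Y)).ncard := by
  classical
  choose C hC using exists_ncard_modRight_le (H := H) (X := X) hS hSinv hgen
  refine ⟨∑ c, ∑ c', ∑ g ∈ (A c c').coeff.support, C g⁻¹, fun Y hY hinv n e => ?_⟩
  have hout : ∀ j : modRight H Y, Quotient.out j.1 ∈ Y := by
    rintro ⟨_, x, hx, rfl⟩
    obtain ⟨h, hh⟩ := Quotient.exact (s := MulAction.orbitRel Hᵐᵒᵖ X)
      (Quotient.out_eq (s := MulAction.orbitRel Hᵐᵒᵖ X) (Quotient.mk _ x))
    rw [← hh]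
    exact hinv h.unop x hx
  have := hY.fintype
  -- A row over `q_j` can lose the entry at `g` only if `g⁻¹ q_j` leaves `Y`; hence the constants `C
  -- g⁻¹`.
  let bad : G → Finset (modRight H Y) := fun g => {j | g⁻¹ • Quotient.out j.1 ∉ Y}
  have hbad : ∀ g, (bad g).card ≤ C g⁻¹ * (modRight H ((S • Y) \ Y)).ncard := fun g => by
    refine le_trans ?_ (hC g⁻¹ Y hY)
    rw [← Set.ncard_coe_finset, ← Set.ncard_image_of_injective _ Subtype.val_injective]
    refine Set.ncard_le_ncard ?_ (hY.subset (modRight_mono fun x hx => hx.1))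
    rintro _ ⟨j, hj, rfl⟩
    refine ⟨Quotient.out j.1, ⟨hout j, ?_⟩, Quotient.out_eq _⟩
    simpa [bad] using hj
  have hsub : boundaryRows H A (fun j : modRight H Y => Quotient.out j.1) e ⊆
      Finset.univ.biUnion fun c => Finset.univ.biUnion fun c' =>
        (A c c').coeff.support.biUnion fun g => (bad g).image fun j => e.symm (j, c) := by
    intro a ha
    simp only [boundaryRows, Finset.mem_filter, Finset.mem_univ, true_and] at ha
    obtain ⟨c', g, hg, hj⟩ := ha
    simp only [Finset.mem_biUnion, Finset.mem_univ, true_and, Finset.mem_image]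
    refine ⟨(e a).2, c', g, hg, (e a).1, ?_, by simp⟩
    simp only [bad, Finset.mem_filter, Finset.mem_univ, true_and]
    -- Were `g⁻¹ q_j` in `Y`, the representative of its orbit would supply the entry assumed
    -- missing.
    intro hY'
    set y := g⁻¹ • Quotient.out (e a).1.1 with hy
    obtain ⟨h, hh⟩ := Quotient.exact (s := MulAction.orbitRel Hᵐᵒᵖ X)
      (Quotient.out_eq (s := MulAction.orbitRel Hᵐᵒᵖ X) (Quotient.mk _ y))
    refine hj ⟨Quotient.mk _ y, y, hY', rfl⟩ ⟨h.unop, ?_⟩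
    rw [MulOpposite.op_unop]
    dsimp only
    rw [← hh]
    change g • h • y = _
    rw [smul_comm g h, hy, smul_inv_smul]
  refine (Finset.card_le_card hsub).trans ?_
  simp only [Finset.sum_mul]
  refine Finset.card_biUnion_le.trans (Finset.sum_le_sum fun c _ => ?_)
  refine Finset.card_biUnion_le.trans (Finset.sum_le_sum fun c' _ => ?_)
  refine Finset.card_biUnion_le.trans (Finset.sum_le_sum fun g _ => ?_)
  exact Finset.card_image_le.trans (hbad g)

theorem algebraicEigenvaluesOver_of_amenableExhaustion {S : Set G} (hS : S.Finite)
    (hSinv : ∀ s ∈ S, s⁻¹ ∈ S) (hgen : Subgroup.closure S = ⊤) [Nonempty X]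
    (hG : ∀ (g : G) (x : X), g • x = x → g = 1)
    (hH : ∀ (h : H) (x : X), MulOpposite.op h • x = x → h = 1)
    {E : ℕ → Set X} (hE : IsAmenableExhaustion H S E) (hK : AlgebraicEigenvaluesOver K H) :
    AlgebraicEigenvaluesOver K G := by
  intro d A z hz
  by_contra hza
  obtain ⟨f, hf⟩ := hz.exists_hasEigenvector
  obtain ⟨τ, hτ, hlow⟩ := exists_le_card_boundaryRows (H := H) (X := X) hG hH A
    (Module.End.mem_eigenspace_iff.1 hf.1) hf.2
  obtain ⟨C, hC⟩ := exists_card_boundaryRows_le (H := H) (X := X) hS hSinv hgen A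
  -- With `C + 1` the threshold makes sense even for `C = 0`, and `C * boundary < τ N` still
  -- follows.
  have hlim : ∀ᶠ k in Filter.atTop, ((modRight H ((S • E k) \ E k)).ncard : ℝ) /
      ((modRight H (E k)).ncard : ℝ) < τ / (C + 1) :=
    hE.tendsto_ratio.eventually_lt_const (by positivity)
  obtain ⟨x₀⟩ := ‹Nonempty X›
  -- Beyond `k₀` the set `E k` is nonempty; for empty `E k` the ratio is `0 / 0 = 0` and says
  -- nothing.
  obtain ⟨k₀, hk₀⟩ := Set.mem_iUnion.1 (hE.exhausts ▸ Set.mem_univ x₀)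
  obtain ⟨k, hk, hkk⟩ := (hlim.and (Filter.eventually_ge_atTop k₀)).exists
  have hfin := hE.finite_mod k
  have := hfin.fintype
  have hpos : 0 < (modRight H (E k)).ncard :=
    (Set.ncard_pos hfin).2 ⟨_, x₀, hE.mono hkk hk₀, rfl⟩
  let e := (Fintype.equivFin (modRight H (E k) × Fin d)).symm
  have h1 := hlow (modRight H (E k)) _ (fun j => Quotient.out j.1) e (fun i j h hij => by
    apply Subtype.ext
    rw [← Quotient.out_eq i.1, ← Quotient.out_eq j.1]
    exact Quotient.sound ⟨_, hij.symm⟩) fun h => hza (hK _ _ _ h)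
  have h2 := hC (E k) hfin (hE.invariant k) _ e
  rw [div_lt_div_iff₀ (by exact_mod_cast hpos) (by positivity)] at hk
  rw [← Nat.card_eq_fintype_card, Nat.card_coe_set_eq] at h1
  have h3 : ((boundaryRows H A (fun j : modRight H (E k) => Quotient.out j.1) e).card : ℝ) ≤
      C * (modRight H ((S • E k) \ E k)).ncard := by exact_mod_cast h2
  nlinarith [Nat.cast_nonneg (α := ℝ) (modRight H ((S • E k) \ E k)).ncard]

end Main

end

end L2Group

theorem mainTheorem11 (G : Type u) [Group G] (H : Type v) [Group H]
    (hGH : L2Group.IsGeneralizedAmenableExtension.{w, u, v} G H) :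
    (L2Group.AlgebraicEigenvalueProperty H → L2Group.AlgebraicEigenvalueProperty G) ∧
    (L2Group.RationalAlgebraicEigenvalueProperty H →
      L2Group.RationalAlgebraicEigenvalueProperty G) := by
  obtain ⟨S, hS, hSinv, hgen, X, _, _, hX, hcomm, hG, hH, E, hE⟩ := hGH
  have : SMulCommClass G Hᵐᵒᵖ X := ⟨fun g h x => hcomm g h.unop x⟩
  exact ⟨L2Group.algebraicEigenvaluesOver_of_amenableExhaustion hS hSinv hgen hG hH hE,
    L2Group.algebraicEigenvaluesOver_of_amenableExhaustion hS hSinv hgen hG hH hE⟩
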